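/- **Setting.** For $n,q\in\mathbb N$ the $(n,q)$-triangle game is played on the edges of the complete graph $K_n$ with vertex set $V$. In every turn Maker claims one unclaimed edge, then Breaker claims $q$ unclaimed edges (or all remaining ones, if there are fewer); the game ends when all edges are claimed. Let $\deg_M(v)$, $\deg_B(v)$ be the numbers of Maker- and Breaker-edges at $v$; an index $t$ means "directly after turn $t$", and $t=0$ means the beginning of the game. Put $\beta=q^2/n$ and, for a constant $\delta\in(0,1)$, \[p_0=\frac{8n}{q^2(1-\delta)(3+\delta)},\qquad \mu=1+\frac{6\beta\ln n}{\delta q},\] \[\deg^*(v)=n-p_0\Big(\frac{q^2(1-\delta)(3+\delta)}8-\deg_M(v)\Big(q-\frac{\deg_M(v)}2\Big)\Big),\qquad d(v)=\deg^*(v)-\deg_B(v).\] Let $\mathrm{pot}(v)=0$ if $\deg_M(v)+\deg_B(v)=n-1$ and $\mathrm{pot}(v)=\mu^{d(v)/q}$ otherwise; for an unclaimed edge $e=\{u,w\}$ let $\mathrm{pot}(e)=\mathrm{pot}(u)+\mathrm{pot}(w)$; and let $\mathrm{POT}_t=\sum_{v\in V}\mathrm{pot}_t(v)$. **Breaker's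 strategy.** Let $\{u,v\}$ be the edge claimed by Maker in turn $t$. *Part 1.* For every $w$ such that $\{v,w\}$ was a Maker-edge before the turn, Breaker claims an edge at $u$: the edge $\{u,w\}$ if it is unclaimed, otherwise an arbitrary unclaimed edge at $u$, and if there is none, an arbitrary unclaimed edge. In the same way, with $u$ and $v$ exchanged, he claims $\deg_{M,t-1}(u)$ edges at $v$. These claims are made in any order, and as far as his $q$ edges suffice. *Part 2.* As long as he has claimed fewer than $q$ edges in this turn and unclaimed edges are left, he claims an unclaimed edge $e$ whose current potential $\mathrm{pot}(e)$ is maximum among all unclaimed edges. **Theorem.** Let $\varepsilon^*>0$, $\beta_0=\frac83+\varepsilon^*$, $B\in\mathbb R$ and $0<\delta<1-\frac{8}{3\beta_0}$. There is an $N$, depending only on $\varepsilon^*,B,\delta$, such that for all $n\ge N$ and all $q\in\mathbb N$ with $q=\sqrt{\beta n}$ for some $\beta\in[\beta_0,B]$ (for instance $\beta=\beta_0$, if $\beta_0n$ is a perfect square), the following holds: whenever Breaker follows the strategy above, however Maker plays and however the arbitrary choices of Breaker are made, $\mathrm{POT}_s<2n$ for the beginning of the game ($s=0$) and after every turn $s$.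 -/

import Mathlib

namespace TriangleGame

/-- A position of a Maker-Breaker game on the edges of the complete graph with vertex set `Fin n`:
the edges claimed so far by Maker and by Breaker. -/
structure Position (n : ℕ) where
  /-- the edges of the Maker graph -/
  maker : Finset (Sym2 (Fin n))
  /-- the edges of the Breaker graph -/
  breaker : Finset (Sym2 (Fin n))

namespace Position

/-- The beginning of the game: nothing is claimed. -/
def start (n : ℕ) : Position n := ⟨∅, ∅⟩

variable {n : ℕ}

/-- `e` is an edge of the complete graph that nobody has claimed yet. -/
def Unclaimed (P : Position n) (e : Sym2 (Fin n)) : Prop :=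
  ¬ e.IsDiag ∧ e ∉ P.maker ∧ e ∉ P.breaker

/-- All edges are claimed, i.e. the game is over. -/
def Full (P : Position n) : Prop := ∀ e, ¬ P.Unclaimed e

/-- The position after Maker claims `e`. -/
def claimM (P : Position n) (e : Sym2 (Fin n)) : Position n := ⟨insert e P.maker, P.breaker⟩

/-- The position after Breaker claims `e`. -/
def claimB (P : Position n) (e : Sym2 (Fin n)) : Position n := ⟨P.maker, insert e P.breaker⟩

/-- The Maker-degree of `v`. -/
def degM (P : Position n) (v : Fin n) : ℕ := (P.maker.filter (fun e => v ∈ e)).card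

/-- The Breaker-degree of `v`. -/
def degB (P : Position n) (v : Fin n) : ℕ := (P.breaker.filter (fun e => v ∈ e)).card

end Position

/-! ### The potential function -/

noncomputable section Potential

/-- The balance of a vertex at the beginning of the game. -/
def p₀ (n q : ℕ) (δ : ℝ) : ℝ := 8 * n / ((q : ℝ) ^ 2 * (1 - δ) * (3 + δ))

/-- The base of the potential function. -/
def μ (n q : ℕ) (β δ : ℝ) : ℝ := 1 + 6 * β * Real.log n / (δ * q)

variable {n : ℕ}

/-- The balanced Breaker-degree of `v`. -/
def balancedDeg (q : ℕ) (δ : ℝ) (P : Position n) (v : Fin n) : ℝ :=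
  n - p₀ n q δ *
    ((q : ℝ) ^ 2 * (1 - δ) * (3 + δ) / 8 - (P.degM v : ℝ) * ((q : ℝ) - (P.degM v : ℝ) / 2))

/-- The deficit of `v`. -/
def deficit (q : ℕ) (δ : ℝ) (P : Position n) (v : Fin n) : ℝ :=
  balancedDeg q δ P v - P.degB v

/-- The potential of a vertex; it is `0` if all `n - 1` edges at `v` are claimed. -/
def pot (q : ℕ) (β δ : ℝ) (P : Position n) (v : Fin n) : ℝ :=
  if P.degM v + P.degB v + 1 = n then 0 else μ n q β δ ^ (deficit q δ P v / q)

/-- The potential of an edge `{u, w}` is the sum of the potentials of `u` and `w`. -/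
def edgePot (q : ℕ) (β δ : ℝ) (P : Position n) (e : Sym2 (Fin n)) : ℝ :=
  Sym2.lift ⟨fun u w => pot q β δ P u + pot q β δ P w, fun _ _ => add_comm _ _⟩ e

/-- The total potential of a position. -/
def totalPot (q : ℕ) (β δ : ℝ) (P : Position n) : ℝ := ∑ v, pot q β δ P v

end Potential

/-! ### The strategy of Breaker -/

section Strategy

variable {n : ℕ}

/-- `(h, w)` is a closing task when Maker claims `{u, v}` in the position `P`: the new edge
creates the Maker-path `h - x - w` with `{h, x} = {u, v}` and `{x, w}` an old Maker-edge, so that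
Breaker wants to claim an edge with head `h`, namely `{h, w}` if this is possible.
There are `deg_M(v)` tasks with head `u` and `deg_M(u)` tasks with head `v`. -/
def IsTask (P : Position n) (u v : Fin n) (d : Fin n × Fin n) : Prop :=
  (d.1 = u ∧ s(v, d.2) ∈ P.maker) ∨ (d.1 = v ∧ s(u, d.2) ∈ P.maker)

/-- In the position `P` the task `d = (h, w)` allows Breaker to claim `e`: this must be `{h, w}`
if that edge is unclaimed; otherwise it is an arbitrary unclaimed edge at `h` if there is one;
otherwise it is an arbitrary unclaimed edge. -/
def IsClosingMove (P : Position n) (d : Fin n × Fin n) (e : Sym2 (Fin n)) : Prop :=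
  P.Unclaimed e ∧
    (P.Unclaimed s(d.1, d.2) → e = s(d.1, d.2)) ∧
    ((∃ e', P.Unclaimed e' ∧ d.1 ∈ e') → d.1 ∈ e)

/-- Breaker may claim `e` as a free edge: it has maximum potential among all unclaimed edges. -/
def IsFreeMove (q : ℕ) (β δ : ℝ) (P : Position n) (e : Sym2 (Fin n)) : Prop :=
  P.Unclaimed e ∧ ∀ e', P.Unclaimed e' → edgePot q β δ P e' ≤ edgePot q β δ P e

/-- `ClosingPhase L P Q`: from `P`, Breaker can reach `Q` by working off the tasks in `L` one after
the other (stopping early only if no unclaimed edge is left). -/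
inductive ClosingPhase : List (Fin n × Fin n) → Position n → Position n → Prop
  | nil (P : Position n) : ClosingPhase [] P P
  | cons {d : Fin n × Fin n} {L : List (Fin n × Fin n)} {P Q : Position n} {e : Sym2 (Fin n)} :
      IsClosingMove P d e → ClosingPhase L (P.claimB e) Q → ClosingPhase (d :: L) P Q
  | full {d : Fin n × Fin n} {L : List (Fin n × Fin n)} {P : Position n} :
      P.Full → ClosingPhase (d :: L) P P

/-- `FreePhase q β δ k P Q`: from `P`, Breaker can reach `Q` by claiming `k` free edges one after
the other (stopping early only if no unclaimed edge is left). -/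
inductive FreePhase (q : ℕ) (β δ : ℝ) : ℕ → Position n → Position n → Prop
  | zero (P : Position n) : FreePhase q β δ 0 P P
  | succ {k : ℕ} {P Q : Position n} {e : Sym2 (Fin n)} :
      IsFreeMove q β δ P e → FreePhase q β δ k (P.claimB e) Q → FreePhase q β δ (k + 1) P Q
  | full {k : ℕ} {P : Position n} : P.Full → FreePhase q β δ (k + 1) P P

/-- One turn from `P` to `P'`: Maker claims an arbitrary unclaimed edge `{u, v}`; then Breaker
works off all closing tasks, in any order `L` (as far as his `q` edges suffice), and claims the
rest of his `q` edges as free edges. -/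
def Turn (q : ℕ) (β δ : ℝ) (P P' : Position n) : Prop :=
  ∃ u v : Fin n, P.Unclaimed s(u, v) ∧
    ∃ L : List (Fin n × Fin n), L.Nodup ∧ (∀ d, d ∈ L ↔ IsTask P u v d) ∧
      ∃ Q : Position n, ClosingPhase (L.take q) (P.claimM s(u, v)) Q ∧
        FreePhase q β δ (q - L.length) Q P'

/-- `P 0, P 1, …, P T` are the positions at the beginning and directly after the turns `1, …, T`
of a (finished or unfinished) game in which Maker plays arbitrarily and Breaker follows
the strategy. -/
def IsPlay (q : ℕ) (β δ : ℝ) (T : ℕ) (P : ℕ → Position n) : Prop :=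
  P 0 = Position.start n ∧ ∀ t < T, Turn q β δ (P t) (P (t + 1))

end Strategy

end TriangleGame

/-! The quantity that does not grow is not the total potential but `totalPot + (μ - 1) * maxPot`,
where `maxPot` is the largest potential of an unclaimed edge. Write η = μ - 1, M and M' for `maxPot`
before and after a turn, and κ for the fraction of free edges among Breaker's q. When Maker claims
{u, v}, the closing edges repay part of the growth of the deficits at u and v; since p₀ ≤ 1, each
deficit grows by at most p₀κq, so by Bernoulli's inequality the total gains at most p₀κηM. The free
edges take off at least κη/(1+η)·M'. If M' is close to M, this loss wins because p₀ < 1; if M' is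
much smaller, the drop of the term ηM pays (`amortized_step`).

This requires κ to be bounded below. A total below 2n makes all deficits at unsaturated vertices
small, and p₀ is tuned so that (1-δ)q/2 Maker edges correspond to balanced degree n. Hence a vertex
with an unclaimed edge has Maker-degree at most (1/2 - δ/8)q (`degM_le_of_totalPot_lt`), so κ ≥ δ/4.
Both facts are carried through one induction over the turns (`IsPlay.totalPot_lt`). The condition
β(1-δ) > 8/3 yields p₀ ≤ 1 - δ/4. -/

namespace TriangleGame

/-! ### Valid positions, degrees and saturated vertices. -/

namespace Position

variable {n : ℕ}

/-- The positions that can occur in a game: no loop is claimed, and no edge is claimed twice. -/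
structure Valid (P : Position n) : Prop where
  maker_not_isDiag : ∀ e ∈ P.maker, ¬ e.IsDiag
  breaker_not_isDiag : ∀ e ∈ P.breaker, ¬ e.IsDiag
  disjoint : Disjoint P.maker P.breaker

/-- All edges at `v` are claimed. -/
def Saturated (P : Position n) (v : Fin n) : Prop := ∀ e, P.Unclaimed e → v ∉ e

lemma valid_start : (start n).Valid :=
  ⟨by simp [start], by simp [start], by simp [start]⟩

lemma Valid.claimM {P : Position n} (hP : P.Valid) {e : Sym2 (Fin n)} (he : P.Unclaimed e) :
    (P.claimM e).Valid := by
  refine ⟨?_, hP.2, ?_⟩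
  · intro f hf
    rcases Finset.mem_insert.1 hf with rfl | hf
    · exact he.1
    · exact hP.1 f hf
  · exact Finset.disjoint_insert_left.2 ⟨he.2.2, hP.3⟩

lemma Valid.claimB {P : Position n} (hP : P.Valid) {e : Sym2 (Fin n)} (he : P.Unclaimed e) :
    (P.claimB e).Valid := by
  refine ⟨hP.1, ?_, ?_⟩
  · intro f hf
    rcases Finset.mem_insert.1 hf with rfl | hf
    · exact he.1
    · exact hP.2 f hf
  · exact Finset.disjoint_insert_right.2 ⟨he.2.1, hP.3⟩

lemma Unclaimed.of_claimM {P : Position n} {e f : Sym2 (Fin n)} (h : (P.claimM e).Unclaimed f) :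
    P.Unclaimed f :=
  ⟨h.1, fun hf => h.2.1 (Finset.mem_insert_of_mem hf), h.2.2⟩

lemma Unclaimed.of_claimB {P : Position n} {e f : Sym2 (Fin n)} (h : (P.claimB e).Unclaimed f) :
    P.Unclaimed f :=
  ⟨h.1, h.2.1, fun hf => h.2.2 (Finset.mem_insert_of_mem hf)⟩

lemma degM_claimM {P : Position n} {e : Sym2 (Fin n)} (he : P.Unclaimed e) (v : Fin n) :
    (P.claimM e).degM v = P.degM v + if v ∈ e then 1 else 0 := by
  unfold degM Position.claimM
  rw [Finset.filter_insert]
  split_ifs with h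
  · rw [Finset.card_insert_of_notMem (fun hf => he.2.1 (Finset.mem_filter.1 hf).1)]
  · rfl

lemma degB_claimB {P : Position n} {e : Sym2 (Fin n)} (he : P.Unclaimed e) (v : Fin n) :
    (P.claimB e).degB v = P.degB v + if v ∈ e then 1 else 0 := by
  unfold degB Position.claimB
  rw [Finset.filter_insert]
  split_ifs with h
  · rw [Finset.card_insert_of_notMem (fun hf => he.2.2 (Finset.mem_filter.1 hf).1)]
  · rfl

@[simp] lemma degB_claimM (P : Position n) (e : Sym2 (Fin n)) (v : Fin n) :
    (P.claimM e).degB v = P.degB v := rfl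

@[simp] lemma degM_claimB (P : Position n) (e : Sym2 (Fin n)) (v : Fin n) :
    (P.claimB e).degM v = P.degM v := rfl

lemma card_filter_mem_eq (s : Finset (Sym2 (Fin n))) (v : Fin n) :
    (s.filter (fun e => v ∈ e)).card = (Finset.univ.filter (fun w => s(v, w) ∈ s)).card := by
  symm
  refine Finset.card_bij (fun w _ => s(v, w)) ?_ ?_ ?_
  · intro w hw
    simpa using hw
  · intro a _ b _ h
    exact Sym2.congr_right.1 h
  · intro e he
    obtain ⟨he, hv⟩ := Finset.mem_filter.1 he
    obtain ⟨w, rfl⟩ := hv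
    exact ⟨w, by simpa using he, rfl⟩

lemma degB_le (P : Position n) (v : Fin n) : P.degB v ≤ n := by
  unfold degB
  rw [card_filter_mem_eq]
  exact (Finset.card_le_univ _).trans (by simp)

/-- In a valid position the claimed edges at `v` number `n - 1` exactly if `v` is saturated. -/
lemma Valid.degM_add_degB_iff {P : Position n} (hP : P.Valid) (v : Fin n) :
    P.degM v + P.degB v + 1 = n ↔ P.Saturated v := by
  have hcard : P.degM v + P.degB v =
      (Finset.univ.filter (fun w => s(v, w) ∈ P.maker ∪ P.breaker)).card := by
    rw [← card_filter_mem_eq, Finset.filter_union, Finset.card_union_of_disjoint]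
    · rfl
    · exact Finset.disjoint_filter_filter hP.3
  set S := Finset.univ.filter (fun w => s(v, w) ∈ P.maker ∪ P.breaker) with hS
  have hv : v ∉ S := by
    intro h
    have h := (Finset.mem_filter.1 h).2
    rcases Finset.mem_union.1 h with h | h
    · exact hP.1 _ h (by simp)
    · exact hP.2 _ h (by simp)
  rw [hcard, ← Finset.card_insert_of_notMem hv]
  have h1 : (insert v S).card = n ↔ insert v S = Finset.univ := by
    rw [← Finset.card_eq_iff_eq_univ]; simp
  rw [h1]
  constructor
  · intro h e he hve
    obtain ⟨w, rfl⟩ := hve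
    have hw : w ∈ insert v S := h ▸ Finset.mem_univ w
    rcases Finset.mem_insert.1 hw with rfl | hw
    · exact he.1 (by simp)
    · have hw := (Finset.mem_filter.1 hw).2
      rcases Finset.mem_union.1 hw with h | h
      · exact he.2.1 h
      · exact he.2.2 h
  · intro h
    refine Finset.eq_univ_iff_forall.2 fun w => ?_
    by_contra hw
    rw [Finset.mem_insert, not_or] at hw
    have hw2 : s(v, w) ∉ P.maker ∪ P.breaker := fun h => hw.2 (Finset.mem_filter.2 ⟨Finset.mem_univ w, h⟩)
    rw [Finset.mem_union, not_or] at hw2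
    exact h s(v, w) ⟨by simpa using Ne.symm hw.1, hw2.1, hw2.2⟩ (by simp)

end Position

/-! ### Change of the potential under single claims. -/

section PotentialBounds

variable {n q : ℕ} {β δ : ℝ}

lemma pot_nonneg (hμ : 1 ≤ μ n q β δ) (P : Position n) (v : Fin n) : 0 ≤ pot q β δ P v := by
  unfold pot
  split_ifs
  · exact le_rfl
  · positivity

lemma pot_le_rpow (hμ : 1 ≤ μ n q β δ) (P : Position n) (v : Fin n) :
    pot q β δ P v ≤ μ n q β δ ^ (deficit q δ P v / q) := by
  unfold pot
  split_ifs
  · positivity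
  · exact le_rfl

lemma pot_eq_zero {P : Position n} (hP : P.Valid) {v : Fin n} (h : P.Saturated v) :
    pot q β δ P v = 0 := by
  rw [pot, if_pos ((hP.degM_add_degB_iff v).2 h)]

lemma pot_eq_rpow {P : Position n} (hP : P.Valid) {v : Fin n} {e : Sym2 (Fin n)}
    (he : P.Unclaimed e) (hv : v ∈ e) :
    pot q β δ P v = μ n q β δ ^ (deficit q δ P v / q) := by
  rw [pot, if_neg]
  intro h
  exact (hP.degM_add_degB_iff v).1 h e he hv

lemma pot_congr {P Q : Position n} {v : Fin n} (hM : Q.degM v = P.degM v)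
    (hB : Q.degB v = P.degB v) : pot q β δ Q v = pot q β δ P v := by
  simp only [pot, deficit, balancedDeg, hM, hB]

lemma edgePot_mk (P : Position n) (u w : Fin n) :
    edgePot q β δ P s(u, w) = pot q β δ P u + pot q β δ P w := rfl

lemma edgePot_nonneg (hμ : 1 ≤ μ n q β δ) (P : Position n) (e : Sym2 (Fin n)) :
    0 ≤ edgePot q β δ P e := by
  induction e with
  | _ u w => exact add_nonneg (pot_nonneg hμ P u) (pot_nonneg hμ P w)

lemma edgePot_le_mul {P Q : Position n} {c : ℝ}
    (h : ∀ w, pot q β δ Q w ≤ c * pot q β δ P w) (e : Sym2 (Fin n)) :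
    edgePot q β δ Q e ≤ c * edgePot q β δ P e := by
  induction e with
  | _ u w =>
    rw [edgePot_mk, edgePot_mk, mul_add]
    exact add_le_add (h u) (h w)

lemma sum_ite_mem_edge (f : Fin n → ℝ) {u w : Fin n} (h : u ≠ w) :
    ∑ x, (if x ∈ s(u, w) then f x else 0) = f u + f w := by
  rw [← Finset.sum_filter]
  have : Finset.univ.filter (fun x => x ∈ s(u, w)) = {u, w} := by
    ext x; simp
  rw [this, Finset.sum_pair h]

/-- A Breaker edge decreases the potentials of its ends at least by the factor `μ ^ (-1 / q)`. -/
lemma pot_claimB_le_of_mem (hμ : 1 ≤ μ n q β δ) (hq : 0 < q) {P : Position n} (hP : P.Valid)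
    {e : Sym2 (Fin n)} (he : P.Unclaimed e) {v : Fin n} (hv : v ∈ e) :
    pot q β δ (P.claimB e) v ≤ (1 - (μ n q β δ - 1) / (q * μ n q β δ)) * pot q β δ P v := by
  have hμ0 : 0 < μ n q β δ := by linarith
  have hq' : (1 : ℝ) ≤ q := by exact_mod_cast hq
  have hdef : deficit q δ (P.claimB e) v = deficit q δ P v - 1 := by
    simp only [deficit, balancedDeg, Position.degM_claimB, Position.degB_claimB he, if_pos hv]
    push_cast; ring
  -- Bernoulli's inequality with base 1/μ and exponent 1/q ≤ 1.
  have hfac : (μ n q β δ)⁻¹ ^ (1 / (q : ℝ)) ≤ 1 - (μ n q β δ - 1) / (q * μ n q β δ) := by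
    have h := rpow_one_add_le_one_add_mul_self (s := (μ n q β δ)⁻¹ - 1)
      (by have := inv_nonneg.2 hμ0.le; linarith) (p := 1 / (q : ℝ)) (by positivity)
      (by rw [div_le_one (by positivity)]; exact hq')
    rw [add_sub_cancel] at h
    refine h.trans (le_of_eq ?_)
    field_simp
    ring
  -- Only an upper bound holds for the new position: the claim may saturate `v`, whose potential
  -- then drops to 0.
  refine (pot_le_rpow hμ _ _).trans ?_
  rw [hdef, pot_eq_rpow hP he hv, sub_div, Real.rpow_sub hμ0, div_eq_mul_inv, mul_comm,
    ← Real.inv_rpow hμ0.le]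
  exact mul_le_mul_of_nonneg_right hfac (by positivity)

lemma pot_claimB_of_notMem {P : Position n} {e : Sym2 (Fin n)} (he : P.Unclaimed e) {v : Fin n}
    (hv : v ∉ e) : pot q β δ (P.claimB e) v = pot q β δ P v :=
  pot_congr (by simp) (by simp [Position.degB_claimB he, hv])

lemma pot_claimM_of_notMem {P : Position n} {e : Sym2 (Fin n)} (he : P.Unclaimed e) {v : Fin n}
    (hv : v ∉ e) : pot q β δ (P.claimM e) v = pot q β δ P v :=
  pot_congr (by simp [Position.degM_claimM he, hv]) (by simp)

lemma pot_claimB_le (hμ : 1 ≤ μ n q β δ) (hq : 0 < q) {P : Position n} (hP : P.Valid)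
    {e : Sym2 (Fin n)} (he : P.Unclaimed e) (v : Fin n) :
    pot q β δ (P.claimB e) v ≤ pot q β δ P v := by
  by_cases hv : v ∈ e
  · refine (pot_claimB_le_of_mem hμ hq hP he hv).trans ?_
    have h1 : 0 ≤ (μ n q β δ - 1) / (q * μ n q β δ) :=
      div_nonneg (by linarith) (mul_nonneg (Nat.cast_nonneg q) (by linarith))
    nlinarith [pot_nonneg hμ P v]
  · exact (pot_claimB_of_notMem he hv).le

lemma totalPot_claimB_le (hμ : 1 ≤ μ n q β δ) (hq : 0 < q) {P : Position n} (hP : P.Valid)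
    {e : Sym2 (Fin n)} (he : P.Unclaimed e) :
    totalPot q β δ (P.claimB e) + (μ n q β δ - 1) / (q * μ n q β δ) * edgePot q β δ P e
      ≤ totalPot q β δ P := by
  set c := (μ n q β δ - 1) / (q * μ n q β δ) with hc
  have hsum : edgePot q β δ P e = ∑ x, (if x ∈ e then pot q β δ P x else 0) := by
    have hd := he.1
    clear he
    induction e with
    | _ u w => rw [sum_ite_mem_edge _ (by simpa using hd)]; rfl
  rw [hsum, Finset.mul_sum, totalPot, totalPot, ← Finset.sum_add_distrib]
  refine Finset.sum_le_sum fun x _ => ?_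
  split_ifs with hx
  · have := pot_claimB_le_of_mem hμ hq hP he hx
    rw [← hc] at this
    linarith
  · rw [pot_claimB_of_notMem he hx]; simp

/-- The maximum potential of an unclaimed edge (`0` if there is none). -/
noncomputable def maxPot (q : ℕ) (β δ : ℝ) (P : Position n) : ℝ :=
  ⨆ e : {e // P.Unclaimed e}, edgePot q β δ P e.1

lemma edgePot_le_maxPot {P : Position n} {e : Sym2 (Fin n)} (he : P.Unclaimed e) :
    edgePot q β δ P e ≤ maxPot q β δ P :=
  le_ciSup (f := fun e : {e // P.Unclaimed e} => edgePot q β δ P e.1)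
    (Set.finite_range _).bddAbove ⟨e, he⟩

/-- The hypothesis `0 ≤ c` covers the full position, where the supremum over the empty family is 0.
-/
lemma maxPot_le {P : Position n} {c : ℝ} (hc : 0 ≤ c)
    (h : ∀ e, P.Unclaimed e → edgePot q β δ P e ≤ c) : maxPot q β δ P ≤ c :=
  Real.iSup_le (fun e => h e.1 e.2) hc

lemma maxPot_nonneg (hμ : 1 ≤ μ n q β δ) (P : Position n) : 0 ≤ maxPot q β δ P :=
  Real.iSup_nonneg fun e => edgePot_nonneg hμ P e.1

end PotentialBounds

/-! ### The closing phase and the free phase. -/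

section Phases

variable {n q : ℕ} {β δ : ℝ}

/-- The relation between two positions of which the second arises from the first by
Breaker edges. -/
structure BreakerReaches (q : ℕ) (β δ : ℝ) (P Q : Position n) : Prop where
  valid : Q.Valid
  degM_eq : ∀ v, Q.degM v = P.degM v
  unclaimed : ∀ e, Q.Unclaimed e → P.Unclaimed e
  pot_le : ∀ v, pot q β δ Q v ≤ pot q β δ P v

lemma BreakerReaches.refl {P : Position n} (hP : P.Valid) : BreakerReaches q β δ P P :=
  ⟨hP, fun _ => rfl, fun _ h => h, fun _ => le_rfl⟩

lemma BreakerReaches.trans {P Q R : Position n} (h₁ : BreakerReaches q β δ P Q)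
    (h₂ : BreakerReaches q β δ Q R) : BreakerReaches q β δ P R :=
  ⟨h₂.valid, fun v => (h₂.degM_eq v).trans (h₁.degM_eq v),
    fun e he => h₁.unclaimed e (h₂.unclaimed e he), fun v => (h₂.pot_le v).trans (h₁.pot_le v)⟩

lemma BreakerReaches.claimB (hμ : 1 ≤ μ n q β δ) (hq : 0 < q) {P : Position n} (hP : P.Valid)
    {e : Sym2 (Fin n)} (he : P.Unclaimed e) : BreakerReaches q β δ P (P.claimB e) :=
  ⟨hP.claimB he, fun _ => rfl,
    fun _ h => h.of_claimB, pot_claimB_le hμ hq hP he⟩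

lemma ClosingPhase.breakerReaches (hμ : 1 ≤ μ n q β δ) (hq : 0 < q) {L : List (Fin n × Fin n)}
    {P Q : Position n} (h : ClosingPhase L P Q) (hP : P.Valid) : BreakerReaches q β δ P Q := by
  induction h with
  | nil P => exact .refl hP
  | cons he _ ih =>
    exact (BreakerReaches.claimB hμ hq hP he.1).trans (ih (hP.claimB he.1))
  | full _ => exact .refl hP

/-- After the closing phase a vertex is saturated or has received one Breaker edge for each task
of which it is the head. -/
lemma ClosingPhase.saturated_or_degB {L : List (Fin n × Fin n)}
    {P Q : Position n} (h : ClosingPhase L P Q) (v : Fin n) :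
    Q.Saturated v ∨ P.degB v + L.countP (fun d => d.1 = v) ≤ Q.degB v := by
  induction h with
  | nil P => right; simp
  | @cons d L P Q e he hQ ih =>
    rcases ih with h | h
    · exact .inl h
    by_cases hv : d.1 = v
    · by_cases hs : ∃ e', P.Unclaimed e' ∧ d.1 ∈ e'
      · right
        have hve : v ∈ e := hv ▸ he.2.2 hs
        rw [Position.degB_claimB he.1, if_pos hve] at h
        rw [List.countP_cons_of_pos (by simpa using hv)]
        omega
      -- With no unclaimed edge at `v` left for the task, `v` stays saturated, because Breaker's
      -- claims only shrink the set of unclaimed edges.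
      · left
        intro e' he' hve'
        have : ∀ {L : List (Fin n × Fin n)} {P Q : Position n}, ClosingPhase L P Q →
            Q.Unclaimed e' → P.Unclaimed e' := by
          intro L P Q h
          induction h with
          | nil P => exact id
          | cons _ _ ih => exact fun h => (ih h).of_claimB
          | full _ => exact id
        exact hs ⟨e', (this hQ he').of_claimB, hv ▸ hve'⟩
    · right
      rw [List.countP_cons_of_neg (by simpa using hv)]
      exact le_trans (by rw [Position.degB_claimB he.1]; omega) h
  | full hf => exact .inl fun e he => (hf e he).elim

lemma FreePhase.breakerReaches (hμ : 1 ≤ μ n q β δ) (hq : 0 < q) {k : ℕ}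
    {P Q : Position n} (h : FreePhase q β δ k P Q) (hP : P.Valid) : BreakerReaches q β δ P Q := by
  induction h with
  | zero P => exact .refl hP
  | succ he _ ih =>
    exact (BreakerReaches.claimB hμ hq hP he.1).trans (ih (hP.claimB he.1))
  | full _ => exact .refl hP

/-- Each free edge decreases the total potential in proportion to the maximum edge potential at
the end of the phase. -/
lemma FreePhase.totalPot_le (hμ : 1 ≤ μ n q β δ) (hq : 0 < q) {k : ℕ}
    {P Q : Position n} (h : FreePhase q β δ k P Q) (hP : P.Valid) :
    totalPot q β δ Q + k * ((μ n q β δ - 1) / (q * μ n q β δ) * maxPot q β δ Q)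
      ≤ totalPot q β δ P := by
  have hc : 0 ≤ (μ n q β δ - 1) / (q * μ n q β δ) :=
    div_nonneg (by linarith) (mul_nonneg (Nat.cast_nonneg q) (by linarith))
  induction h with
  | zero P => simp
  | @succ k P Q e he hQ ih =>
    have h1 := ih (hP.claimB he.1)
    have h2 := totalPot_claimB_le hμ hq hP he.1
    have hr := (BreakerReaches.claimB hμ hq hP he.1).trans
      (hQ.breakerReaches hμ hq (hP.claimB he.1))
    -- An edge still unclaimed at the end was a candidate when `e` was chosen, with at least its
    -- final potential.
    have h3 : maxPot q β δ Q ≤ edgePot q β δ P e := by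
      refine maxPot_le (edgePot_nonneg hμ P e) fun f hf => ?_
      refine le_trans ?_ (he.2 f (hr.unclaimed f hf))
      simpa using edgePot_le_mul (c := 1) (fun w => by simpa using hr.pot_le w) f
    have h4 := mul_le_mul_of_nonneg_left h3 hc
    push_cast
    linarith
  | @full k P hf =>
    have : IsEmpty {e // P.Unclaimed e} := ⟨fun e => hf e.1 e.2⟩
    -- The maximum is 0 here, so the free edges that cannot be claimed need no decrease.
    rw [maxPot, Real.iSup_of_isEmpty]
    simp

lemma countP_fst_eq {P : Position n} {u v : Fin n} (huv : u ≠ v) {L : List (Fin n × Fin n)}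
    (hL : L.Nodup) (h : ∀ d, d ∈ L ↔ IsTask P u v d) :
    L.countP (fun d => d.1 = u) = P.degM v := by
  unfold Position.degM
  rw [Position.card_filter_mem_eq, List.countP_eq_length_filter,
    ← List.toFinset_card_of_nodup (hL.filter _)]
  symm
  refine Finset.card_bij (fun w _ => (u, w)) ?_ ?_ ?_
  · intro w hw
    have hw := (Finset.mem_filter.1 hw).2
    simp only [List.mem_toFinset, List.mem_filter, decide_true, and_true]
    exact (h _).2 (.inl ⟨rfl, hw⟩)
  · intro a _ b _ hab
    exact (Prod.mk.inj hab).2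
  · rintro ⟨x, w⟩ hd
    simp only [List.mem_toFinset, List.mem_filter, decide_eq_true_eq] at hd
    obtain ⟨hd, rfl⟩ := hd
    rcases (h _).1 hd with hd | hd
    · exact ⟨w, by simpa using hd.2, rfl⟩
    · exact (huv hd.1).elim

lemma length_tasks {P : Position n} {u v : Fin n} (huv : u ≠ v) {L : List (Fin n × Fin n)}
    (hL : L.Nodup) (h : ∀ d, d ∈ L ↔ IsTask P u v d) :
    L.length = P.degM u + P.degM v := by
  have h' : ∀ d, d ∈ L ↔ IsTask P v u d := fun d => (h d).trans or_comm
  have hcongr : L.countP (fun d => ¬ (decide (d.1 = u)) = true) = L.countP (fun d => d.1 = v) := by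
    refine List.countP_congr fun d hd => ?_
    simp only [decide_eq_true_eq]
    rcases (h d).1 hd with hd | hd
    · simp [hd.1, huv]
    · simp [hd.1, huv.symm]
  rw [List.length_eq_countP_add_countP (fun d => decide (d.1 = u)), countP_fst_eq huv hL h, hcongr,
    countP_fst_eq huv.symm hL h', add_comm]

end Phases

/-! ### Amortized analysis of one turn. -/

section TurnBounds

variable {n q : ℕ} {β δ : ℝ}

/-- By the choice of p₀ the constant terms cancel, so all deficits start at 0. -/
lemma deficit_eq (hn : p₀ n q δ * ((q : ℝ) ^ 2 * (1 - δ) * (3 + δ) / 8) = n) (P : Position n)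
    (v : Fin n) :
    deficit q δ P v = p₀ n q δ * ((P.degM v : ℝ) * (q - P.degM v / 2)) - P.degB v := by
  rw [deficit, balancedDeg, mul_sub, hn]; ring

/-- The growth of the potential at an end of Maker's edge, after the closing edges. -/
lemma pot_le_of_closing (hμ : 1 ≤ μ n q β δ) (hq : 0 < q) (hp0 : 0 ≤ p₀ n q δ)
    (hp1 : p₀ n q δ ≤ 1)
    (hn : p₀ n q δ * ((q : ℝ) ^ 2 * (1 - δ) * (3 + δ) / 8) = n) {P Q : Position n}
    (hP : P.Valid) (hQ : Q.Valid) {e : Sym2 (Fin n)} (he : P.Unclaimed e) {u : Fin n} (hu : u ∈ e)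
    {m k : ℕ} (hk : k + (P.degM u + m) = q) (hM : Q.degM u = P.degM u + 1)
    (hB : Q.Saturated u ∨ P.degB u + m ≤ Q.degB u) :
    pot q β δ Q u ≤ (1 + p₀ n q δ * (k / q) * (μ n q β δ - 1)) * pot q β δ P u := by
  have hq' : (0 : ℝ) < q := by exact_mod_cast hq
  have hkq : (k : ℝ) ≤ q := by exact_mod_cast (by omega : k ≤ q)
  have hx : p₀ n q δ * (k / q) ≤ 1 :=
    mul_le_one₀ hp1 (by positivity) ((div_le_one hq').2 hkq)
  have hx0 : 0 ≤ p₀ n q δ * (k / q) := by positivity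
  rcases hB with hB | hB
  · rw [pot_eq_zero hQ hB]
    exact mul_nonneg (add_nonneg zero_le_one (mul_nonneg hx0 (by linarith))) (pot_nonneg hμ P u)
  · have hμ0 : 0 < μ n q β δ := by linarith
    -- The Maker edge adds p₀(q - deg_M(u) - 1/2) to the balanced degree, and at least `m` Breaker
    -- edges are subtracted. Since p₀m ≤ m, the net growth is at most p₀(q - deg_M(u) - m) = p₀k.
    have hdef : deficit q δ Q u ≤ deficit q δ P u + p₀ n q δ * k := by
      rw [deficit_eq hn, deficit_eq hn, hM]
      have h1 : (P.degB u : ℝ) + m ≤ Q.degB u := by exact_mod_cast hB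
      have h2 : (k : ℝ) = q - (P.degM u + m) := by rw [← hk]; push_cast; ring
      rw [h2]
      push_cast
      have h3 : p₀ n q δ * m ≤ m := mul_le_of_le_one_left (Nat.cast_nonneg m) hp1
      nlinarith
    have hb := rpow_one_add_le_one_add_mul_self (s := μ n q β δ - 1) (by linarith) hx0 hx
    rw [add_sub_cancel] at hb
    refine (pot_le_rpow hμ Q u).trans ?_
    rw [pot_eq_rpow hP he hu]
    calc μ n q β δ ^ (deficit q δ Q u / q)
        ≤ μ n q β δ ^ (p₀ n q δ * (k / q) + deficit q δ P u / q) := by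
          refine Real.rpow_le_rpow_of_exponent_le hμ ?_
          calc deficit q δ Q u / q ≤ (deficit q δ P u + p₀ n q δ * k) / q := by gcongr
            _ = _ := by ring
      _ = μ n q β δ ^ (p₀ n q δ * (k / q)) * μ n q β δ ^ (deficit q δ P u / q) :=
          Real.rpow_add hμ0 _ _
      _ ≤ _ := mul_le_mul_of_nonneg_right hb (by positivity)

/-- The amortized potential does not increase in a turn in which Breaker has enough
free edges. -/
lemma amortized_step {η p κ S S' M M' : ℝ} (hη : 0 ≤ η) (hM : 0 ≤ M) (hκ1 : κ ≤ 1)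
    (hgap : η ≤ κ * (1 - p)) (hM' : M' ≤ (1 + η) * M)
    (hS : S' + κ * η / (1 + η) * M' ≤ S + p * κ * η * M) : S' + η * M' ≤ S + η * M := by
  obtain ⟨y, rfl⟩ : ∃ y, M' = (1 + η) * y := ⟨M' / (1 + η), by field_simp⟩
  have hy : y ≤ M := le_of_mul_le_mul_left hM' (by linarith)
  have h1 : κ * η / (1 + η) * ((1 + η) * y) = κ * η * y := by field_simp
  rw [h1] at hS
  -- The coefficient of `y` is nonnegative, so the worst case is `y = M`, where the claim reduces to
  -- `hgap`.
  have h2 : (1 - κ + η) * y ≤ (1 - κ + η) * M := mul_le_mul_of_nonneg_left hy (by linarith)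
  have h3 : η * M ≤ κ * (1 - p) * M := mul_le_mul_of_nonneg_right hgap hM
  have h4 : η * ((1 - κ + η) * y) ≤ η * ((1 - p * κ) * M) :=
    mul_le_mul_of_nonneg_left (by nlinarith) hη
  nlinarith

/-- At most 2cq of Breaker's edges are closing edges, so κ ≥ 1 - 2c; `hgap` then supplies the gap
needed in `amortized_step`. -/
lemma Turn.amortized (hμ : 1 ≤ μ n q β δ) (hq : 0 < q) (hp0 : 0 ≤ p₀ n q δ)
    (hp1 : p₀ n q δ ≤ 1)
    (hn : p₀ n q δ * ((q : ℝ) ^ 2 * (1 - δ) * (3 + δ) / 8) = n) {c : ℝ}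
    (hgap : μ n q β δ - 1 ≤ (1 - 2 * c) * (1 - p₀ n q δ)) {P P' : Position n}
    (hP : P.Valid) (hdeg : ∀ e, P.Unclaimed e → ∀ v ∈ e, (P.degM v : ℝ) ≤ c * q) (hc : c ≤ 1 / 2)
    (hT : Turn q β δ P P') :
    P'.Valid ∧ (∀ v, P'.degM v = P.degM v ∨ P'.degM v = P.degM v + 1 ∧ (P.degM v : ℝ) ≤ c * q) ∧
      totalPot q β δ P' + (μ n q β δ - 1) * maxPot q β δ P'
        ≤ totalPot q β δ P + (μ n q β δ - 1) * maxPot q β δ P := by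
  obtain ⟨u, v, he, L, hL, hLt, Q, hC, hF⟩ := hT
  have huv : u ≠ v := by simpa using he.1
  have hq' : (0 : ℝ) < q := by exact_mod_cast hq
  have hlen := length_tasks huv hL hLt
  have hmu := hdeg _ he u (by simp)
  have hmv := hdeg _ he v (by simp)
  have hle : P.degM u + P.degM v ≤ q := by
    have : (P.degM u : ℝ) + P.degM v ≤ q := by nlinarith
    exact_mod_cast this
  -- All closing tasks fit into the q edges, so the truncation is void.
  rw [List.take_of_length_le (by omega)] at hC
  obtain ⟨k, hk⟩ : ∃ k, k + (P.degM u + P.degM v) = q := ⟨q - (P.degM u + P.degM v), by omega⟩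
  rw [show q - L.length = k by omega] at hF
  have hP1 := hP.claimM he
  have hrC := hC.breakerReaches (β := β) (δ := δ) hμ hq hP1
  have hrF := hF.breakerReaches hμ hq hrC.valid
  have hr := hrC.trans hrF
  have hkap : (k : ℝ) = q - (P.degM u + P.degM v) := by rw [← hk]; push_cast; ring
  have hkq : (k : ℝ) / q ≤ 1 := (div_le_one hq').2 (by exact_mod_cast (by omega : k ≤ q))
  have hkc : 1 - 2 * c ≤ (k : ℝ) / q := by rw [le_div_iff₀ hq', hkap]; linarith
  set η := μ n q β δ - 1 with hη
  have hη0 : 0 ≤ η := by linarith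
  set g := p₀ n q δ * (k / q) * η with hg
  have hg0 : 0 ≤ g := by positivity
  have hpu : pot q β δ Q u ≤ (1 + g) * pot q β δ P u := by
    refine pot_le_of_closing hμ hq hp0 hp1 hn hP hrC.valid he (by simp) hk
      (by rw [hrC.degM_eq, Position.degM_claimM he]; simp) ?_
    have := hC.saturated_or_degB u
    rwa [countP_fst_eq huv hL hLt] at this
  have hpv : pot q β δ Q v ≤ (1 + g) * pot q β δ P v := by
    refine pot_le_of_closing hμ hq hp0 hp1 hn hP hrC.valid he (by simp)
      (by rw [add_comm (P.degM v)]; exact hk)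
      (by rw [hrC.degM_eq, Position.degM_claimM he]; simp) ?_
    have := hC.saturated_or_degB v
    rwa [countP_fst_eq huv.symm hL fun d => (hLt d).trans or_comm] at this
  have hpw : ∀ w, w ∉ s(u, v) → pot q β δ Q w ≤ pot q β δ P w := fun w hw => by
    rw [← pot_claimM_of_notMem he hw]; exact hrC.pot_le w
  have hpQ : ∀ w, pot q β δ Q w ≤ pot q β δ P w + g * (if w ∈ s(u, v) then pot q β δ P w else 0) := by
    intro w
    split_ifs with hw
    · rcases Sym2.mem_iff.1 hw with rfl | rfl
      · linarith
      · linarith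
    · simpa using hpw w hw
  have htot : totalPot q β δ Q ≤ totalPot q β δ P + g * maxPot q β δ P := by
    calc totalPot q β δ Q
        ≤ ∑ w, (pot q β δ P w + g * (if w ∈ s(u, v) then pot q β δ P w else 0)) :=
          Finset.sum_le_sum fun w _ => hpQ w
      _ = totalPot q β δ P + g * edgePot q β δ P s(u, v) := by
          rw [Finset.sum_add_distrib, ← Finset.mul_sum, sum_ite_mem_edge _ huv, edgePot_mk, totalPot]
      _ ≤ _ := by gcongr; exact edgePot_le_maxPot he
  have hmax : maxPot q β δ P' ≤ (1 + η) * maxPot q β δ P := by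
    have hM0 := maxPot_nonneg hμ P
    refine maxPot_le (by positivity) fun e he' => ?_
    have hgη : g ≤ η := mul_le_of_le_one_left hη0 (mul_le_one₀ hp1 (by positivity) hkq)
    calc edgePot q β δ P' e ≤ (1 + η) * edgePot q β δ P e := by
          refine edgePot_le_mul (fun w => ?_) e
          have h0 := pot_nonneg hμ P w
          have h1 := (hrF.pot_le w).trans (hpQ w)
          split_ifs at h1
          · nlinarith
          · nlinarith
      _ ≤ _ := by
          gcongr
          exact edgePot_le_maxPot (hr.unclaimed e he').of_claimM
  refine ⟨hr.valid, fun w => ?_, ?_⟩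
  · rw [hr.degM_eq, Position.degM_claimM he]
    split_ifs with hw
    · exact .inr ⟨rfl, hdeg _ he w hw⟩
    · exact .inl rfl
  · refine amortized_step (p := p₀ n q δ) (κ := k / q) hη0 (maxPot_nonneg hμ P) hkq ?_ hmax ?_
    · exact hgap.trans (mul_le_mul_of_nonneg_right hkc (by linarith))
    · have h1 := hF.totalPot_le hμ hq hrC.valid
      have h2 : (k : ℝ) * ((μ n q β δ - 1) / (q * μ n q β δ) * maxPot q β δ P')
          = k / q * η / (1 + η) * maxPot q β δ P' := by
        rw [← hη, show μ n q β δ = 1 + η by rw [hη]; ring]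
        field_simp
      rw [h2] at h1
      have h3 : g * maxPot q β δ P = p₀ n q δ * (k / q) * η * maxPot q β δ P := rfl
      linarith

end TurnBounds

/-! ### Maker-degrees and the induction over the turns. -/

section Parameters

variable {n q : ℕ} {β δ : ℝ}

/-- A vertex with an unclaimed edge has small Maker-degree as long as the total potential is
below `2 * n`. -/
lemma degM_le_of_totalPot_lt (hδ₀ : 0 < δ) (hδ₁ : δ < 1) (hq : 0 < q) (hμ : 1 < μ n q β δ)
    (hn : p₀ n q δ * ((q : ℝ) ^ 2 * (1 - δ) * (3 + δ) / 8) = n)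
    (hlog : q * Real.log (2 * n) ≤ δ / 3 * n * Real.log (μ n q β δ)) (hn0 : 0 < n)
    {P : Position n} (hP : P.Valid) (hpot : totalPot q β δ P < 2 * n)
    {e : Sym2 (Fin n)} (he : P.Unclaimed e) {v : Fin n} (hv : v ∈ e) (hdeg : P.degM v ≤ q) :
    (P.degM v : ℝ) ≤ (1 / 2 - δ / 8) * q := by
  have hq' : (0 : ℝ) < q := by exact_mod_cast hq
  have hn' : (0 : ℝ) < n := by exact_mod_cast hn0
  have hdeg' : (P.degM v : ℝ) ≤ q := by exact_mod_cast hdeg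
  have hB : (P.degB v : ℝ) ≤ n := by exact_mod_cast P.degB_le v
  have hlogμ : 0 < Real.log (μ n q β δ) := Real.log_pos hμ
  have hv1 : pot q β δ P v < 2 * n :=
    (Finset.single_le_sum (fun w _ => pot_nonneg hμ.le P w) (Finset.mem_univ v)).trans_lt hpot
  rw [pot_eq_rpow hP he hv] at hv1
  have h1 := Real.log_lt_log (Real.rpow_pos_of_pos (by linarith) _) hv1
  rw [Real.log_rpow (by linarith), div_mul_eq_mul_div, div_lt_iff₀ hq'] at h1
  have h2 : deficit q δ P v < δ / 3 * n := by
    refine lt_of_mul_lt_mul_right ?_ hlogμ.le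
    linarith
  rw [deficit_eq hn] at h2
  set m : ℝ := (P.degM v : ℝ)
  by_contra! hm
  have hpp : 0 < p₀ n q δ := by
    by_contra! h
    have : p₀ n q δ * ((q : ℝ) ^ 2 * (1 - δ) * (3 + δ) / 8) ≤ 0 :=
      mul_nonpos_of_nonpos_of_nonneg h
        (by have : 0 < 1 - δ := by linarith
            positivity)
    linarith
  -- The map m ↦ m(q - m/2) increases up to m = q; this is where `hdeg` enters.
  have h3 : (q : ℝ) ^ 2 * (1 / 2 - δ / 8) * (3 / 4 + δ / 16) ≤ m * (q - m / 2) := by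
    nlinarith
  -- At m = (1-δ)q/2 the map takes the value q²(1-δ)(3+δ)/8; the room up to (1/2 - δ/8)q pays for
  -- the factor 1 + δ/3.
  have h4 : (1 + δ / 3) * ((q : ℝ) ^ 2 * (1 - δ) * (3 + δ) / 8)
      ≤ (q : ℝ) ^ 2 * (1 / 2 - δ / 8) * (3 / 4 + δ / 16) := by
    have : (1 + δ / 3) * ((1 - δ) * (3 + δ) / 8) ≤ (1 / 2 - δ / 8) * (3 / 4 + δ / 16) := by
      nlinarith [pow_pos hδ₀ 2, pow_pos hδ₀ 3]
    have := mul_le_mul_of_nonneg_left this (sq_nonneg (q : ℝ))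
    linarith
  have h5 := mul_le_mul_of_nonneg_left (h4.trans h3) hpp.le
  have h6 : p₀ n q δ * ((1 + δ / 3) * ((q : ℝ) ^ 2 * (1 - δ) * (3 + δ) / 8)) = (1 + δ / 3) * n := by
    rw [← hn]; ring
  linarith

lemma IsPlay.totalPot_lt (hδ₀ : 0 < δ) (hδ₁ : δ < 1) (hq : 2 ≤ q) (hμ : 1 < μ n q β δ)
    (hμδ : μ n q β δ - 1 ≤ δ ^ 2 / 16) (hp0 : 0 ≤ p₀ n q δ) (hp1 : p₀ n q δ ≤ 1 - δ / 4)
    (hn : p₀ n q δ * ((q : ℝ) ^ 2 * (1 - δ) * (3 + δ) / 8) = n)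
    (hlog : q * Real.log (2 * n) ≤ δ / 3 * n * Real.log (μ n q β δ)) (hn0 : 0 < n)
    {T : ℕ} {P : ℕ → Position n} (hP : IsPlay q β δ T P) {s : ℕ} (hs : s ≤ T) :
    totalPot q β δ (P s) < 2 * n := by
  have hn1 : (1 : ℝ) ≤ n := by exact_mod_cast hn0
  have hq2 : (2 : ℝ) ≤ q := by exact_mod_cast hq
  have hδ2 : δ ^ 2 ≤ 1 := by nlinarith
  -- The crude bound by `q` belongs to the invariant because the sharper degree bound relies on it.
  -- It survives a turn since (1/2 - δ/8)q + 1 ≤ q for q ≥ 2.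
  have key : ∀ s ≤ T, (P s).Valid ∧ (∀ v, (P s).degM v ≤ q) ∧
      totalPot q β δ (P s) + (μ n q β δ - 1) * maxPot q β δ (P s)
        ≤ n + (μ n q β δ - 1) * 2 := by
    intro s
    induction s with
    | zero =>
      intro _
      rw [hP.1]
      have hpot : ∀ v, pot q β δ (Position.start n) v ≤ 1 := fun v => by
        refine (pot_le_rpow hμ.le _ v).trans (le_of_eq ?_)
        rw [deficit_eq hn]
        simp [Position.start, Position.degM, Position.degB]
      refine ⟨Position.valid_start, fun v => by simp [Position.start, Position.degM], ?_⟩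
      refine add_le_add ?_ (mul_le_mul_of_nonneg_left ?_ (by linarith))
      · exact (Finset.sum_le_sum fun v _ => hpot v).trans (by simp)
      · refine maxPot_le zero_le_two fun e _ => ?_
        induction e with
        | _ u w => rw [edgePot_mk]; linarith [hpot u, hpot w]
    | succ t ih =>
      intro ht
      obtain ⟨hv, hd, hΦ⟩ := ih (by omega)
      have hlt : totalPot q β δ (P t) < 2 * n := by
        have := mul_nonneg (sub_nonneg.2 hμ.le) (maxPot_nonneg hμ.le (P t))
        linarith
      -- With this `c`, both 1 - 2c = δ/4 and 1 - p₀ ≥ δ/4, which explains the bound δ²/16 on μ - 1.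
      obtain ⟨h1, h2, h3⟩ := Turn.amortized hμ.le (by omega) hp0 (by linarith) hn
        (c := 1 / 2 - δ / 8) (by nlinarith) hv
        (fun e he v hve => degM_le_of_totalPot_lt hδ₀ hδ₁ (by omega) hμ hn hlog hn0 hv hlt he hve
          (hd v))
        (by linarith) (hP.2 t (by omega))
      refine ⟨h1, fun v => ?_, h3.trans hΦ⟩
      rcases h2 v with h | ⟨h, h'⟩
      · exact h ▸ hd v
      · rw [h]
        have : ((P t).degM v : ℝ) + 1 ≤ q := by nlinarith
        exact_mod_cast this
  have := (key s hs).2.2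
  have := mul_nonneg (sub_nonneg.2 hμ.le) (maxPot_nonneg hμ.le (P s))
  linarith

/-- `log n` is eventually below any positive multiple of `√n`. -/
lemma exists_forall_log_le {c : ℝ} (hc : 0 < c) :
    ∃ N : ℕ, 4 ≤ N ∧ ∀ n : ℕ, N ≤ n → Real.log n ≤ c * Real.sqrt n := by
  have h := (isLittleO_log_rpow_atTop (r := 1 / 2) (by norm_num)).bound hc
  obtain ⟨N, hN⟩ := Filter.eventually_atTop.1 (tendsto_natCast_atTop_atTop.eventually h)
  refine ⟨max 4 N, le_max_left _ _, fun n hn => ?_⟩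
  have h1 := hN n ((le_max_right _ _).trans hn)
  rw [← Real.sqrt_eq_rpow, Real.norm_of_nonneg (Real.sqrt_nonneg _)] at h1
  exact (le_abs_self _).trans h1

end Parameters

end TriangleGame

/-! ### The constants for large n. -/

theorem theorem1 (ε B δ : ℝ) (hε : 0 < ε) (hδ₀ : 0 < δ) (hδ₁ : δ < 1 - 8 / (3 * (8 / 3 + ε))) :
    ∃ N : ℕ, ∀ n : ℕ, N ≤ n → ∀ (q : ℕ) (β : ℝ), 8 / 3 + ε ≤ β → β ≤ B →
      (q : ℝ) = Real.sqrt (β * n) →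
      ∀ (T : ℕ) (P : ℕ → TriangleGame.Position n), TriangleGame.IsPlay q β δ T P →
        ∀ s ≤ T, TriangleGame.totalPot q β δ (P s) < 2 * n := by
  have hδlt : δ < 1 := by
    have : 0 < 8 / (3 * (8 / 3 + ε)) := by positivity
    linarith
  -- Chosen so that 6B·δ³/(96B) = δ³/16, giving η ≤ δ²/16. The `max` keeps the constant positive
  -- before B ≥ β is available.
  obtain ⟨N, hN4, hN⟩ := TriangleGame.exists_forall_log_le
    (c := δ ^ 3 / (96 * max B 1)) (by positivity)
  refine ⟨N, fun n hn q β hβ hβB hq T P hP s hs => ?_⟩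
  have hn4 : 4 ≤ n := hN4.trans hn
  have hn4' : (4 : ℝ) ≤ n := by exact_mod_cast hn4
  have hβ1 : 1 ≤ β := by linarith
  have hBmax : max B 1 = B := max_eq_left (hβ1.trans hβB)
  have hB0 : 0 < B := by linarith
  have hlogn := hN n hn
  rw [hBmax] at hlogn
  have hqsq : (q : ℝ) ^ 2 = β * n := by rw [hq, Real.sq_sqrt (by positivity)]
  have hqn : Real.sqrt n ≤ q := by
    rw [hq]; exact Real.sqrt_le_sqrt (by nlinarith)
  have hq2 : (2 : ℝ) ≤ q := by
    refine le_trans ?_ hqn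
    exact Real.le_sqrt_of_sq_le (by linarith)
  have hq0 : (0 : ℝ) < q := by linarith
  have hlog4 : 2 * Real.log 2 ≤ Real.log n := by
    rw [← Real.log_rpow (by norm_num) 2]
    exact Real.log_le_log (by norm_num) (by norm_num; exact hn4)
  have hlog2 : 0 < Real.log 2 := Real.log_pos (by norm_num)
  have hlogpos : 0 < Real.log n := by linarith
  set η := 6 * β * Real.log n / (δ * q) with hη
  have hμ : TriangleGame.μ n q β δ = 1 + η := rfl
  have hη0 : 0 < η := by positivity
  have hη1 : η ≤ δ ^ 2 / 16 := by
    rw [hη, div_le_iff₀ (by positivity)]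
    calc 6 * β * Real.log n ≤ 6 * B * (δ ^ 3 / (96 * B) * q) := by
          have : Real.log n ≤ δ ^ 3 / (96 * B) * q := hlogn.trans (by gcongr)
          gcongr
      _ = δ ^ 2 / 16 * (δ * q) := by field_simp; norm_num
  have hβδ : 8 / 3 < β * (1 - δ) := by
    have h1 : 8 / (3 * (8 / 3 + ε)) < 1 - δ := by linarith
    rw [div_lt_iff₀ (by positivity)] at h1
    nlinarith
  have h1δ : 0 < 1 - δ := by linarith
  have hp0 : 0 ≤ TriangleGame.p₀ n q δ := by unfold TriangleGame.p₀; positivity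
  have hpn : TriangleGame.p₀ n q δ * ((q : ℝ) ^ 2 * (1 - δ) * (3 + δ) / 8) = n := by
    unfold TriangleGame.p₀; field_simp
  have hp1 : TriangleGame.p₀ n q δ ≤ 1 - δ / 4 := by
    unfold TriangleGame.p₀
    rw [div_le_iff₀ (by positivity), hqsq]
    have h1 : 8 ≤ (1 - δ / 4) * (3 + δ) * (β * (1 - δ)) := by
      -- The product equals 3 + δ(1-δ)/4.
      have h3 : 3 ≤ (1 - δ / 4) * (3 + δ) := by nlinarith
      nlinarith
    have := mul_le_mul_of_nonneg_right h1 (Nat.cast_nonneg (α := ℝ) n)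
    linarith
  refine TriangleGame.IsPlay.totalPot_lt hδ₀ hδlt (by exact_mod_cast hq2) (by rw [hμ]; linarith)
    (by rw [hμ]; linarith) hp0 hp1 hpn ?_ (by omega) hP hs
  have h1 : η / (1 + η) ≤ Real.log (1 + η) := by
    have h := Real.one_sub_inv_le_log_of_pos (x := 1 + η) (by linarith)
    refine le_trans (le_of_eq ?_) h
    field_simp
    ring
  have h2 : Real.log (2 * n) ≤ 3 / 2 * Real.log n := by
    rw [Real.log_mul (by norm_num) (by positivity)]; linarith
  have hη3 : η ≤ 1 / 3 := by nlinarith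
  have h3 : 3 / 4 * η ≤ Real.log (1 + η) := by
    refine le_trans ?_ h1
    rw [le_div_iff₀ (by linarith)]
    nlinarith
  rw [hμ]
  -- The factor 6 in `μ` is fitted here: 3/2 comes from n ≥ 4, 3/4 from η ≤ 1/3, and (1/3)·(3/4)·6 =
  -- 3/2.
  calc q * Real.log (2 * n) ≤ q * (3 / 2 * Real.log n) := by gcongr
    _ = δ / 3 * n * (3 / 4 * η) := by
        have hβ0 : 0 < β := by linarith
        have : (n : ℝ) = (q : ℝ) ^ 2 / β := by rw [hqsq]; field_simp
        rw [hη]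
        generalize Real.log n = l
        rw [this]
        field_simp
        ring
    _ ≤ _ := by gcongr
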